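/- Let $\mathcal Q^-(7,2)$ be the elliptic quadric of rank $3$ in ${\rm PG}(7,2)$, that is, the set of points satisfying $x_0x_1+x_2x_3+x_4x_5+g(x_6,x_7)=0$ in suitable homogeneous coordinates, where $g$ is an irreducible homogeneous polynomial of degree $2$ over $\mathbb F_2$. Lines, planes and generators of $\mathcal Q^-(7,2)$ are the projective lines, the projective planes and the maximal projective subspaces contained in the quadric. An $m$-ovoid of $\mathcal Q^-(7,2)$ is a set of its points meeting every generator in exactly $m$ points; it is trivial if it is empty or consists of all points of $\mathcal Q^-(7,2)$. A $1$-system of $\mathcal Q^-(7,2)$ is a set of $2^4+1=17$ pairwise disjoint lines of $\mathcal Q^-(7,2)$ such that every plane of $\mathcal Q^-(7,2)$ containing one of these lines is disjoint from the union of the other lines of the set. Theorem. (1) A non-trivial $m$-ovoid of $\mathcal Q^-(7,2)$ exists if and only if $m=3$ or $m=4$. (2) Every $3$-ovoid of $\mathcal Q^-(7,2)$ is the union of the lines of a $1$-system of $\mathcal Q^-(7,2)$. (3) The $4$-ovoids of $\mathcal Q^-(7,2)$ are exactly the complements, in the point set of $\mathcal Q^-(7,2)$, of the $3$-ovoids of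 $\mathcal Q^-(7,2)$. -/

import Mathlib

namespace PolarSpace

variable {F V : Type*} [Field F] [AddCommGroup V] [Module F V]

/-- `Q` defines an elliptic quadric of rank `r`: the space `V` has a basis, with coordinates
`x₀, …, x₂ᵣ₊₁`, in which
`Q = x₀x₁ + ⋯ + x₂ᵣ₋₂x₂ᵣ₋₁ + g(x₂ᵣ, x₂ᵣ₊₁)`
for an irreducible homogeneous polynomial `g` of degree two in two variables over `F`. -/
def IsElliptic (r : ℕ) (Q : QuadraticForm F V) : Prop :=
  ∃ (b : Module.Basis (Fin (2 * r + 2)) F V) (g : MvPolynomial (Fin 2) F),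
    g.IsHomogeneous 2 ∧ Irreducible g ∧
      ∀ v : V, Q v =
        (∑ i : Fin r, b.repr v ⟨2 * i, by omega⟩ * b.repr v ⟨2 * i + 1, by omega⟩) +
          MvPolynomial.eval
            ![b.repr v ⟨2 * r, by omega⟩, b.repr v ⟨2 * r + 1, by omega⟩] g

/-- The linear subspace `W` is totally singular, that is, the form vanishes on it. -/
def IsTotallySingular (Q : QuadraticForm F V) (W : Submodule F V) : Prop :=
  ∀ w ∈ W, Q w = 0

/-- The set of projective points lying in the projective subspace defined by `W`. -/
def pointsOf (W : Submodule F V) : Set (Projectivization F V) :=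
  {P | P.submodule ≤ W}

/-- The points of the quadric `Q = 0`. -/
def quadricPoints (Q : QuadraticForm F V) : Set (Projectivization F V) :=
  {P | IsTotallySingular Q P.submodule}

/-- The lines of the polar space: totally singular subspaces of vector space dimension two. -/
def IsLine (Q : QuadraticForm F V) (W : Submodule F V) : Prop :=
  IsTotallySingular Q W ∧ Module.finrank F W = 2

/-- The planes of the polar space: totally singular subspaces of vector space dimension three. -/
def IsPlane (Q : QuadraticForm F V) (W : Submodule F V) : Prop :=
  IsTotallySingular Q W ∧ Module.finrank F W = 3

/-- The generators of the polar space: its maximal subspaces. -/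
def IsGenerator (Q : QuadraticForm F V) (W : Submodule F V) : Prop :=
  Maximal (IsTotallySingular Q) W

/-- An `m`-ovoid: a set of points of the quadric that meets every generator in exactly `m`
points. (Used over finite fields only, where all these sets are finite.) -/
def IsOvoid (Q : QuadraticForm F V) (m : ℕ) (O : Set (Projectivization F V)) : Prop :=
  O ⊆ quadricPoints Q ∧ ∀ W : Submodule F V, IsGenerator Q W → (O ∩ pointsOf W).ncard = m

/-- A set of points is a trivial ovoid if it is empty or consists of all points. -/
def IsTrivialOvoid (Q : QuadraticForm F V) (O : Set (Projectivization F V)) : Prop :=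
  O = ∅ ∨ O = quadricPoints Q

/-- A `1`-system of an elliptic quadric in projective dimension seven over the field with `q`
elements: a set of `q ^ 4 + 1` pairwise disjoint lines of the quadric such that every plane of the
quadric through one of these lines is disjoint from the union of the other ones. -/
def IsOneSystem (Q : QuadraticForm F V) (L : Set (Submodule F V)) : Prop :=
  (∀ l ∈ L, IsLine Q l) ∧
  L.ncard = Nat.card F ^ 4 + 1 ∧
  L.PairwiseDisjoint pointsOf ∧
  ∀ l ∈ L, ∀ E : Submodule F V, IsPlane Q E → l ≤ E →
    Disjoint (pointsOf E) (⋃ k ∈ L \ {l}, pointsOf k)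

end PolarSpace

/-! Over F_2 a point is a nonzero vector, so the whole question can be treated with character sums
on a space of 256 vectors. Let S be an m-ovoid. Counting planes through a point (`card_collinear`)
gives |S| = 17m, and gives the Fourier transform of S the value m - 16·1_S at every nonzero singular
vector. Parseval then leaves no room for nonsingular vectors to deviate from m (`charSum_eq`), so
the transform is known everywhere. Fourier inversion of its square shows that, for w in S, exactly
m² + 3m - 16 vectors y in S satisfy w + y ∈ S (`card_lines`).

This number is negative for m < 3, so a nonempty m-ovoid has m ≥ 3. Complementation turns m-ovoids
into (7 - m)-ovoids, which leaves m = 3 and m = 4 and matches the two cases with each other.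

For m = 3 the number is 2: each point of S is on exactly one line inside S, and the 51 points split
into 17 lines. A plane through such a line is a generator, and the three points of the line already
exhaust its intersection with S; hence the lines form a 1-system.

For existence, Q is regarded as the trace of a quadratic form over F_4 in four variables; the
nonzero singular vectors of the latter form a 3-ovoid (`of_cubeRoot`). -/

open Finset

namespace PolarSpace

/-- The nontrivial additive character of the field with two elements. -/
def sgn (a : ZMod 2) : ℤ := if a = 0 then 1 else -1

@[simp] lemma sgn_zero : sgn 0 = 1 := rfl

lemma sgn_add (a b : ZMod 2) : sgn (a + b) = sgn a * sgn b := by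
  revert a b; decide

lemma sgn_of_ne_zero {a : ZMod 2} (h : a ≠ 0) : sgn a = -1 := if_neg h

lemma one_add_sgn (a : ZMod 2) : 1 + sgn a = if a = 0 then 2 else 0 := by
  revert a; decide

/-! ### Gauss sums and counts of orthogonal singular vectors. -/

section VectorSpace

variable {V : Type*} [AddCommGroup V] [Module (ZMod 2) V]

lemma eq_of_add_eq_zero {x y : V} (h : x + y = 0) : x = y := by
  rw [add_eq_zero_iff_eq_neg.1 h, ZModModule.neg_eq_self]

lemma add_add_cancel_self (x y : V) : x + (x + y) = y := by
  rw [← add_assoc, ZModModule.add_self, zero_add]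

variable (Q : QuadraticForm (ZMod 2) V)

local notation "B" => QuadraticMap.polar Q

lemma map_add_eq (x y : V) : Q (x + y) = Q x + Q y + B x y := by
  simp [QuadraticMap.polar]

lemma polar_self_eq_zero (x : V) : B x x = 0 := by
  rw [QuadraticMap.polar_self, two_smul, CharTwo.add_self_eq_zero]

/-- The vectors `p`, `y`, `z` span a totally singular subspace of dimension three. -/
def SpansPlane (p y z : V) : Prop :=
  (Q p = 0 ∧ Q y = 0 ∧ Q z = 0 ∧ B y p = 0 ∧ B z p = 0 ∧ B z y = 0) ∧
    p ≠ 0 ∧ y ≠ 0 ∧ y ≠ p ∧ z ≠ 0 ∧ z ≠ p ∧ z ≠ y ∧ z ≠ p + y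

instance [DecidableEq V] (p y z : V) : Decidable (SpansPlane Q p y z) := by
  unfold SpansPlane; infer_instance

/-- A nondegenerate quadratic form on a space with `256` elements, having `120` singular vectors,
the count being expressed by means of the Gauss sum. -/
structure IsMinusType [Fintype V] : Prop where
  card : Fintype.card V = 256
  nondegenerate : ∀ x, (∀ y, B y x = 0) → x = 0
  gauss : ∑ x, sgn (Q x) = -16

variable {Q}

namespace IsMinusType

variable [Fintype V]

/-- For u ≠ 0, translation by some y with B y u ≠ 0 negates the sum. -/
lemma sum_sgn_polar [DecidableEq V] (h : IsMinusType Q) (u : V) :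
    ∑ x, sgn (B x u) = if u = 0 then 256 else 0 := by
  split_ifs with hu
  · subst hu; simp [h.card]
  · obtain ⟨y, hy⟩ : ∃ y, B y u ≠ 0 := by
      by_contra! hc
      exact hu (h.nondegenerate u hc)
    have := Equiv.sum_comp (Equiv.addRight y) (fun x => sgn (B x u))
    simp only [Equiv.coe_addRight, QuadraticMap.polar_add_left, sgn_add, sgn_of_ne_zero hy] at this
    rw [← Finset.sum_mul] at this
    linarith

/-- Completing the square: B x u = Q (x + u) - Q x - Q u, so the sum is a translated Gauss sum. -/
lemma sum_sgn_mul_sgn_polar (h : IsMinusType Q) (u : V) :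
    ∑ x, sgn (Q x) * sgn (B x u) = -16 * sgn (Q u) := by
  have := Equiv.sum_comp (Equiv.addRight u) (fun x => sgn (Q x))
  simp only [Equiv.coe_addRight, map_add_eq, sgn_add, h.gauss] at this
  have h2 : sgn (Q u) * sgn (Q u) = 1 := by
    rw [← sgn_add, CharTwo.add_self_eq_zero, sgn_zero]
  calc ∑ x, sgn (Q x) * sgn (B x u)
      = (∑ x, sgn (Q x) * sgn (Q u) * sgn (B x u)) * sgn (Q u) := by
        rw [Finset.sum_mul]
        refine Finset.sum_congr rfl fun x _ => ?_
        linear_combination (-(sgn (Q x) * sgn (B x u))) * h2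
    _ = _ := by rw [this]

variable [DecidableEq V]

/-- The number of singular vectors orthogonal to two vectors, up to a factor. -/
lemma eight_mul_card (h : IsMinusType Q) (p y : V) (hp : Q p = 0) (hy : Q y = 0)
    (hpy : B p y = 0) :
    8 * (#{z | Q z = 0 ∧ B z p = 0 ∧ B z y = 0} : ℤ) =
      192 + (if p = 0 then 256 else 0) + (if y = 0 then 256 else 0) +
        (if p + y = 0 then 256 else 0) := by
  have e : 8 * (#{z | Q z = 0 ∧ B z p = 0 ∧ B z y = 0} : ℤ) =
      ∑ z, (1 + sgn (Q z)) * ((1 + sgn (B z p)) * (1 + sgn (B z y))) := by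
    rw [Finset.card_filter, Nat.cast_sum, Finset.mul_sum]
    refine Finset.sum_congr rfl fun z _ => ?_
    rw [one_add_sgn, one_add_sgn, one_add_sgn]
    by_cases h1 : Q z = 0 <;> by_cases h2 : B z p = 0 <;> by_cases h3 : B z y = 0 <;>
      simp [h1, h2, h3]
  -- The characters belong to 0, p, y and p + y, all singular. Each contributes a Gauss sum -16, and
  -- 0 also contributes 256, whence 192 = 256 - 64.
  have e2 : ∀ z, (1 + sgn (Q z)) * ((1 + sgn (B z p)) * (1 + sgn (B z y))) =
      sgn (B z 0) + sgn (B z p) + sgn (B z y) + sgn (B z (p + y)) +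
        (sgn (Q z) * sgn (B z 0) + sgn (Q z) * sgn (B z p) + sgn (Q z) * sgn (B z y) +
          sgn (Q z) * sgn (B z (p + y))) := by
    intro z
    rw [QuadraticMap.polar_add_right, sgn_add, QuadraticMap.polar_zero_right, sgn_zero]
    ring
  rw [e, Finset.sum_congr rfl fun z _ => e2 z]
  simp only [Finset.sum_add_distrib, h.sum_sgn_polar, h.sum_sgn_mul_sgn_polar, map_add_eq, hp, hy,
    hpy, QuadraticMap.map_zero, add_zero, sgn_zero, if_true]
  ring

lemma card_singular_perp (h : IsMinusType Q) {p : V} (hp : Q p = 0) (hp0 : p ≠ 0) :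
    #{z | Q z = 0 ∧ B z p = 0 ∧ z ≠ 0 ∧ z ≠ p} = 54 := by
  have h1 := h.eight_mul_card p p hp hp (polar_self_eq_zero Q p)
  simp only [hp0, if_false, ZModModule.add_self, if_true, and_self] at h1
  have h2 : (univ.filter fun z => Q z = 0 ∧ B z p = 0 ∧ z ≠ 0 ∧ z ≠ p) =
      (univ.filter fun z => Q z = 0 ∧ B z p = 0) \ {0, p} := by
    ext z; simp; tauto
  rw [h2, Finset.card_sdiff_of_subset, Finset.card_pair hp0.symm]
  · omega
  · intro z hz
    simp only [mem_insert, mem_singleton] at hz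
    rcases hz with rfl | rfl
    · simp
    · simp [hp]

lemma card_spansPlane (h : IsMinusType Q) {p y : V} (hp : Q p = 0) (hp0 : p ≠ 0)
    (hy : Q y = 0 ∧ B y p = 0 ∧ y ≠ 0 ∧ y ≠ p) :
    #{z | SpansPlane Q p y z} = 20 := by
  obtain ⟨hy, hyp, hy0, hne⟩ := hy
  have hpy : B p y = 0 := by rw [QuadraticMap.polar_comm, hyp]
  have h1 := h.eight_mul_card p y hp hy hpy
  have hpy0 : p + y ≠ 0 := fun hc => hne ((eq_of_add_eq_zero hc).symm)
  simp only [hp0, hy0, hpy0, if_false] at h1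
  have h2 : (univ.filter fun z => SpansPlane Q p y z) =
      (univ.filter fun z => Q z = 0 ∧ B z p = 0 ∧ B z y = 0) \ {0, p, y, p + y} := by
    ext z; simp [SpansPlane, hp, hp0, hy, hyp, hy0, hne]
  have h3 : #{0, p, y, p + y} = 4 := by
    rw [card_insert_of_notMem, card_insert_of_notMem, card_pair]
    · simpa using hp0
    · simp [hne.symm, hy0]
    · simp [hp0.symm, hy0.symm, hpy0.symm]
  rw [h2, Finset.card_sdiff_of_subset, h3]
  · omega
  · intro z hz
    simp only [mem_insert, mem_singleton] at hz
    rcases hz with rfl | rfl | rfl | rfl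
    · simp
    · simp [hp, hpy]
    · simp [hy, hyp]
    · simp [map_add_eq, QuadraticMap.polar_add_left, hp, hy, hyp, hpy]

end IsMinusType

namespace SpansPlane

variable {p y z : V}

lemma swap (h : SpansPlane Q p y z) : SpansPlane Q p z y := by
  obtain ⟨⟨h1, h2, h3, h4, h5, h6⟩, h7, h8, h9, h10, h11, h12, h13⟩ := h
  refine ⟨⟨h1, h3, h2, h5, h4, by rw [QuadraticMap.polar_comm, h6]⟩, h7, h10, h11, h8, h9,
    h12.symm, ?_⟩
  rintro rfl
  exact h13 (add_add_cancel_self p z).symm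

lemma add_right_p (h : SpansPlane Q p y z) : SpansPlane Q p y (p + z) := by
  obtain ⟨⟨h1, h2, h3, h4, h5, h6⟩, h7, h8, h9, h10, h11, h12, h13⟩ := h
  have h5' : B p z = 0 := by rw [QuadraticMap.polar_comm, h5]
  have h4' : B p y = 0 := by rw [QuadraticMap.polar_comm, h4]
  refine ⟨⟨h1, h2, ?_, h4, ?_, ?_⟩, h7, h8, h9, ?_, ?_, ?_, ?_⟩
  · simp [map_add_eq, h1, h3, h5']
  · simp [QuadraticMap.polar_add_left, h5, CharTwo.two_eq_zero]
  · simp [QuadraticMap.polar_add_left, h6, h4']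
  · exact fun hc => h11 ((eq_of_add_eq_zero hc).symm)
  · simpa using h10
  · rintro rfl
    exact h13 (add_add_cancel_self p z).symm
  · simpa using h12

lemma add_right_y (h : SpansPlane Q p y z) : SpansPlane Q p y (y + z) := by
  obtain ⟨⟨h1, h2, h3, h4, h5, h6⟩, h7, h8, h9, h10, h11, h12, h13⟩ := h
  have h6' : B y z = 0 := by rw [QuadraticMap.polar_comm, h6]
  refine ⟨⟨h1, h2, ?_, h4, ?_, ?_⟩, h7, h8, h9, ?_, ?_, ?_, ?_⟩
  · simp [map_add_eq, h2, h3, h6']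
  · simp [QuadraticMap.polar_add_left, h5, h4]
  · simp [QuadraticMap.polar_add_left, h6, CharTwo.two_eq_zero]
  · exact fun hc => h12 ((eq_of_add_eq_zero hc).symm)
  · rintro rfl
    exact h13 (by rw [add_comm, add_add_cancel_self])
  · simpa using h10
  · rw [add_comm]; simpa using h11

lemma swap_iff : SpansPlane Q p y z ↔ SpansPlane Q p z y := ⟨swap, swap⟩

lemma add_right_p_iff : SpansPlane Q p y (p + z) ↔ SpansPlane Q p y z :=
  ⟨fun h => by simpa [add_add_cancel_self] using h.add_right_p, add_right_p⟩

lemma add_right_y_iff : SpansPlane Q p y (y + z) ↔ SpansPlane Q p y z :=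
  ⟨fun h => by simpa [add_add_cancel_self] using h.add_right_y, add_right_y⟩

variable [Fintype V] [DecidableEq V]

lemma sum_translate_p (φ : V → ℤ) (p y : V) :
    ∑ z, (if SpansPlane Q p y z then φ (p + z) else 0) =
      ∑ z, if SpansPlane Q p y z then φ z else 0 := by
  have := Equiv.sum_comp (Equiv.addLeft p) (fun z => if SpansPlane Q p y z then φ z else 0)
  simpa only [Equiv.coe_addLeft, add_right_p_iff] using this

lemma sum_translate_y (φ : V → ℤ) (p y : V) :
    ∑ z, (if SpansPlane Q p y z then φ (y + z) else 0) =
      ∑ z, if SpansPlane Q p y z then φ z else 0 := by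
  have := Equiv.sum_comp (Equiv.addLeft y) (fun z => if SpansPlane Q p y z then φ z else 0)
  simpa only [Equiv.coe_addLeft, add_right_y_iff] using this

lemma sum_swap (φ : V → ℤ) (p : V) :
    ∑ y, ∑ z, (if SpansPlane Q p y z then φ z else 0) =
      ∑ y, ∑ z, if SpansPlane Q p y z then φ y else 0 := by
  rw [Finset.sum_comm]
  simp only [swap_iff]

/-- Summing over all planes through `p` the values of a function at the points of the plane. -/
lemma sum_plane (φ : V → ℤ) (p : V) :
    ∑ y, ∑ z, (if SpansPlane Q p y z then
      φ p + φ y + φ z + φ (p + y) + φ (p + z) + φ (y + z) + φ (p + (y + z)) else 0) =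
      ∑ y, ∑ z, if SpansPlane Q p y z then φ p + 6 * φ y else 0 := by
  -- Translating z by p or y and exchanging y with z preserve `SpansPlane`, so the six points other
  -- than p all contribute equally.
  have e1 : ∑ y, ∑ z, (if SpansPlane Q p y z then φ (p + z) else 0) =
      ∑ y, ∑ z, if SpansPlane Q p y z then φ y else 0 := by
    simp only [sum_translate_p φ, sum_swap]
  have e2 : ∑ y, ∑ z, (if SpansPlane Q p y z then φ (y + z) else 0) =
      ∑ y, ∑ z, if SpansPlane Q p y z then φ y else 0 := by
    simp only [sum_translate_y φ, sum_swap]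
  have e3 : ∑ y, ∑ z, (if SpansPlane Q p y z then φ (p + (y + z)) else 0) =
      ∑ y, ∑ z, if SpansPlane Q p y z then φ y else 0 := by
    simp only [sum_translate_y (fun v => φ (p + v)), e1]
  have e4 : ∑ y, ∑ z, (if SpansPlane Q p y z then φ (p + y) else 0) =
      ∑ y, ∑ z, if SpansPlane Q p y z then φ y else 0 := by
    rw [← sum_swap (fun v => φ (p + v)), e1]
  have e5 := sum_swap (Q := Q) φ p
  have l : ∀ y z, (if SpansPlane Q p y z then
      φ p + φ y + φ z + φ (p + y) + φ (p + z) + φ (y + z) + φ (p + (y + z)) else 0) =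
      (if SpansPlane Q p y z then φ p else 0) + (if SpansPlane Q p y z then φ y else 0) +
      (if SpansPlane Q p y z then φ z else 0) + (if SpansPlane Q p y z then φ (p + y) else 0) +
      (if SpansPlane Q p y z then φ (p + z) else 0) +
      (if SpansPlane Q p y z then φ (y + z) else 0) +
      (if SpansPlane Q p y z then φ (p + (y + z)) else 0) := by
    intro y z; split_ifs <;> simp
  have r : ∀ y z, (if SpansPlane Q p y z then φ p + 6 * φ y else 0) =
      (if SpansPlane Q p y z then φ p else 0) + 6 * (if SpansPlane Q p y z then φ y else 0) := by
    intro y z; split_ifs <;> simp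
  simp only [l, r, Finset.sum_add_distrib, ← Finset.mul_sum, e1, e2, e3, e4, e5]
  ring

end SpansPlane

end VectorSpace

/-! ### Poisson summation and the size of generators. -/

section Generators

open scoped Classical

variable {V : Type*} [AddCommGroup V] [Module (ZMod 2) V] {Q : QuadraticForm (ZMod 2) V}

local notation "B" => QuadraticMap.polar Q

lemma IsTotallySingular.polar_eq_zero {W : Submodule (ZMod 2) V} (hW : IsTotallySingular Q W)
    {x y : V} (hx : x ∈ W) (hy : y ∈ W) : B x y = 0 := by
  have := map_add_eq Q x y
  rw [hW _ (W.add_mem hx hy), hW _ hx, hW _ hy] at this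
  simpa using this.symm

/-- A generator contains all singular vectors that are orthogonal to it. -/
lemma IsGenerator.mem_of_perp {W : Submodule (ZMod 2) V} (hW : IsGenerator Q W) {x : V}
    (hx : Q x = 0) (hxW : ∀ u ∈ W, B x u = 0) : x ∈ W := by
  have hts : IsTotallySingular Q (W ⊔ Submodule.span (ZMod 2) {x}) := by
    intro v hv
    obtain ⟨w, hw, z, hz, rfl⟩ := Submodule.mem_sup.1 hv
    obtain ⟨c, rfl⟩ := Submodule.mem_span_singleton.1 hz
    rw [map_add_eq, hW.1 w hw, QuadraticMap.map_smul, hx, QuadraticMap.polar_smul_right,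
      QuadraticMap.polar_comm, hxW w hw]
    simp
  exact hW.2 hts le_sup_left (Submodule.mem_sup_right (Submodule.mem_span_singleton_self x))

variable [Fintype V]

lemma sum_mem_sgn_polar (W : Submodule (ZMod 2) V) (x : V) :
    ∑ u with u ∈ W, sgn (B x u) = if ∀ u ∈ W, B x u = 0 then (#{u | u ∈ W} : ℤ) else 0 := by
  split_ifs with hx
  · rw [Finset.card_eq_sum_ones, Nat.cast_sum]
    refine Finset.sum_congr rfl fun u hu => ?_
    rw [hx u (by simpa using hu)]; simp
  · push Not at hx
    obtain ⟨y, hyW, hy⟩ := hx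
    have : ∑ u with u ∈ W, sgn (B x (u + y)) = ∑ u with u ∈ W, sgn (B x u) :=
      Finset.sum_equiv (Equiv.addRight y)
        (fun u => by simp [W.add_mem_iff_left hyW]) (fun u _ => rfl)
    simp only [QuadraticMap.polar_add_right, sgn_add, sgn_of_ne_zero hy] at this
    rw [← Finset.sum_mul] at this
    linarith

/-- Poisson summation. -/
lemma sum_mem_sum_mul_sgn_polar (W : Submodule (ZMod 2) V) (F : V → ℤ) :
    ∑ u with u ∈ W, ∑ x, F x * sgn (B x u) =
      #{u | u ∈ W} * ∑ x, if ∀ u ∈ W, B x u = 0 then F x else 0 := by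
  rw [Finset.sum_comm, Finset.mul_sum]
  refine Finset.sum_congr rfl fun x _ => ?_
  rw [← Finset.mul_sum, sum_mem_sgn_polar]
  split_ifs <;> ring

namespace IsMinusType

/-- Poisson summation of 1 and of sgn Q over the orthogonal space of W gives 256 / n and -16. By
maximality its singular vectors are those of W, so the two values add up to 2n, which forces n = 8.
-/
lemma card_of_isGenerator (h : IsMinusType Q) {W : Submodule (ZMod 2) V}
    (hW : IsGenerator Q W) : #{u | u ∈ W} = 8 := by
  set n := #{u | u ∈ W} with hn
  have h1 : (256 : ℤ) = n * ∑ x, if ∀ u ∈ W, B x u = 0 then 1 else 0 := by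
    rw [hn, ← sum_mem_sum_mul_sgn_polar W (fun _ => 1)]
    simp only [one_mul, h.sum_sgn_polar]
    simp
  have h2 : (-16 * n : ℤ) = n * ∑ x, if ∀ u ∈ W, B x u = 0 then sgn (Q x) else 0 := by
    rw [hn, ← sum_mem_sum_mul_sgn_polar W (fun x => sgn (Q x))]
    simp only [h.sum_sgn_mul_sgn_polar]
    rw [Finset.card_eq_sum_ones, Nat.cast_sum, Finset.mul_sum]
    refine Finset.sum_congr rfl fun u hu => ?_
    rw [hW.1 u (by simpa using hu)]; simp
  have h3 : ∑ x, (if ∀ u ∈ W, B x u = 0 then (1 : ℤ) else 0) +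
      ∑ x, (if ∀ u ∈ W, B x u = 0 then sgn (Q x) else 0) = 2 * n := by
    rw [← Finset.sum_add_distrib, hn, Finset.card_filter, Nat.cast_sum, Finset.mul_sum]
    refine Finset.sum_congr rfl fun x _ => ?_
    by_cases hx : x ∈ W
    · have : ∀ u ∈ W, B x u = 0 := fun u hu => hW.1.polar_eq_zero hx hu
      rw [if_pos this, if_pos this, if_pos hx, hW.1 x hx]; simp
    · by_cases hp : ∀ u ∈ W, B x u = 0
      · have hq : Q x ≠ 0 := fun hq => hx (hW.mem_of_perp hq hp)
        rw [if_pos hp, if_pos hp, if_neg hx, sgn_of_ne_zero hq]; simp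
      · simp [hp, hx]
  have h4 : (n : ℤ) * (2 * n) = 256 - 16 * n := by rw [← h3]; linarith
  have h5 : ((n : ℤ) - 8) * (n + 16) = 0 := by linarith
  rcases mul_eq_zero.1 h5 with h6 | h6 <;> omega

/-- A maximal totally singular subspace above W also has 8 vectors. -/
lemma isGenerator_of_card (h : IsMinusType Q) {W : Submodule (ZMod 2) V}
    (hW : IsTotallySingular Q W) (hc : #{u | u ∈ W} = 8) : IsGenerator Q W := by
  obtain ⟨W', hle, hW'⟩ := (Set.toFinite {W | IsTotallySingular Q W}).exists_le_maximal hW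
  have : (univ.filter fun u => u ∈ W) = univ.filter fun u => u ∈ W' :=
    Finset.eq_of_subset_of_card_le (fun u hu => by simpa using hle (by simpa using hu))
      (by rw [hc, h.card_of_isGenerator hW'])
  have : W = W' := by
    ext u
    simpa using Finset.ext_iff.1 this u
  exact this ▸ hW'

lemma isGenerator_of_isPlane (h : IsMinusType Q) {W : Submodule (ZMod 2) V}
    (hW : IsPlane Q W) : IsGenerator Q W := by
  refine h.isGenerator_of_card hW.1 ?_
  have := Module.card_eq_pow_finrank (K := ZMod 2) (V := W)
  rw [hW.2, ZMod.card, Fintype.card_subtype] at this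
  exact this

end IsMinusType

lemma exists_isGenerator : ∃ W : Submodule (ZMod 2) V, IsGenerator Q W := by
  have hbot : IsTotallySingular Q (⊥ : Submodule (ZMod 2) V) := by
    intro w hw
    rw [(Submodule.mem_bot _).1 hw, QuadraticMap.map_zero]
  obtain ⟨W, -, hW⟩ := (Set.toFinite {W | IsTotallySingular Q W}).exists_le_maximal hbot
  exact ⟨W, hW⟩

lemma zmod_two_eq_zero_or_one (a : ZMod 2) : a = 0 ∨ a = 1 := by
  revert a; decide

lemma sum_zmod_two {M : Type*} [AddCommMonoid M] (g : ZMod 2 → M) : ∑ a, g a = g 0 + g 1 :=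
  Fin.sum_univ_two g

/-- The linear map with range spanned by three given vectors. -/
noncomputable def planeMap (p y z : V) : (ZMod 2 × ZMod 2 × ZMod 2) →ₗ[ZMod 2] V :=
  (LinearMap.toSpanSingleton (ZMod 2) V p).coprod
    ((LinearMap.toSpanSingleton (ZMod 2) V y).coprod (LinearMap.toSpanSingleton (ZMod 2) V z))

omit [Fintype V] in
lemma planeMap_apply (p y z : V) (a b c : ZMod 2) :
    planeMap p y z (a, b, c) = a • p + (b • y + c • z) := by
  simp [planeMap]

omit [Fintype V] in
lemma SpansPlane.injective {p y z : V} (h : SpansPlane Q p y z) :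
    Function.Injective (planeMap p y z) := by
  obtain ⟨-, h7, h8, h9, h10, h11, h12, h13⟩ := h
  rw [injective_iff_map_eq_zero]
  rintro ⟨a, b, c⟩ h0
  rw [planeMap_apply] at h0
  rcases zmod_two_eq_zero_or_one a with rfl | rfl <;>
  rcases zmod_two_eq_zero_or_one b with rfl | rfl <;>
  rcases zmod_two_eq_zero_or_one c with rfl | rfl <;>
  simp only [zero_smul, one_smul, zero_add, add_zero] at h0
  · rfl
  · exact absurd h0 h10
  · exact absurd h0 h8
  · exact absurd (eq_of_add_eq_zero h0).symm h12
  · exact absurd h0 h7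
  · exact absurd (eq_of_add_eq_zero h0).symm h11
  · exact absurd (eq_of_add_eq_zero h0).symm h9
  · rw [← add_assoc] at h0
    exact absurd (eq_of_add_eq_zero h0).symm h13

lemma filter_mem_range_planeMap (p y z : V) :
    (univ.filter fun u => u ∈ LinearMap.range (planeMap p y z)) =
      univ.image (planeMap p y z) := by
  ext u; simp

omit [Fintype V] in
lemma SpansPlane.isTotallySingular {p y z : V} (h : SpansPlane Q p y z) :
    IsTotallySingular Q (LinearMap.range (planeMap p y z)) := by
  obtain ⟨⟨h1, h2, h3, h4, h5, h6⟩, -⟩ := h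
  rintro _ ⟨⟨a, b, c⟩, rfl⟩
  rw [planeMap_apply]
  simp only [map_add_eq, QuadraticMap.map_smul, h1, h2, h3, QuadraticMap.polar_add_right,
    QuadraticMap.polar_smul_right, QuadraticMap.polar_smul_left, QuadraticMap.polar_comm Q p,
    QuadraticMap.polar_comm Q y z, h4, h5, h6]
  simp

lemma SpansPlane.isGenerator (h : IsMinusType Q) {p y z : V} (hs : SpansPlane Q p y z) :
    IsGenerator Q (LinearMap.range (planeMap p y z)) := by
  refine h.isGenerator_of_card hs.isTotallySingular ?_
  rw [filter_mem_range_planeMap, Finset.card_image_of_injective _ hs.injective]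
  rfl

lemma SpansPlane.sum_range {p y z : V} (hs : SpansPlane Q p y z) (φ : V → ℤ) :
    ∑ u with u ∈ LinearMap.range (planeMap p y z), φ u =
      φ 0 + (φ p + φ y + φ z + φ (p + y) + φ (p + z) + φ (y + z) + φ (p + (y + z))) := by
  rw [filter_mem_range_planeMap, Finset.sum_image fun _ _ _ _ e => hs.injective e]
  simp only [Fintype.sum_prod_type, sum_zmod_two, planeMap_apply, zero_smul, one_smul, zero_add,
    add_zero]
  ring

end Generators

/-! ### Fourier analysis of m-ovoids. -/

section VectorOvoids

open scoped Classical

variable {V : Type*} [AddCommGroup V] [Module (ZMod 2) V] [Fintype V]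

/-- An `m`-ovoid, described by means of the nonzero vectors of its points. -/
def IsVectorOvoid (Q : QuadraticForm (ZMod 2) V) (m : ℕ) (S : Finset V) : Prop :=
  (∀ x ∈ S, x ≠ 0 ∧ Q x = 0) ∧
    ∀ W : Submodule (ZMod 2) V, IsGenerator Q W → #{x ∈ S | x ∈ W} = m

/-- The characteristic function of a finite set. -/
noncomputable def ind (S : Finset V) (x : V) : ℤ := if x ∈ S then 1 else 0

omit [AddCommGroup V] [Module (ZMod 2) V] in
lemma sum_ite_eq_ind {S : Finset V} (P : V → Prop) [DecidablePred P] :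
    ∑ x with P x, ind S x = #{x ∈ S | P x} := by
  simp only [ind, Finset.sum_ite_mem, Finset.card_eq_sum_ones, Nat.cast_sum, Nat.cast_one]
  refine Finset.sum_congr ?_ fun _ _ => rfl
  ext x; simp [and_comm]

/-- The Fourier transform of the characteristic function of a set of vectors. -/
noncomputable def charSum (Q : QuadraticForm (ZMod 2) V) (S : Finset V) (v : V) : ℤ :=
  ∑ x ∈ S, sgn (QuadraticMap.polar Q x v)

variable {Q : QuadraticForm (ZMod 2) V} {m : ℕ} {S : Finset V}

local notation "B" => QuadraticMap.polar Q

omit [Fintype V] in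
lemma charSum_zero : charSum Q S 0 = #S := by
  simp [charSum]

omit [Fintype V] in
lemma card_add_charSum (v : V) : (#S : ℤ) + charSum Q S v = 2 * #{x ∈ S | B x v = 0} := by
  rw [charSum, Finset.card_eq_sum_ones, Nat.cast_sum, ← Finset.sum_add_distrib,
    Finset.card_filter, Nat.cast_sum, Finset.mul_sum]
  refine Finset.sum_congr rfl fun x _ => ?_
  rw [Nat.cast_one, one_add_sgn]
  split_ifs <;> simp

namespace IsMinusType

lemma sum_charSum (h : IsMinusType Q) (h0 : 0 ∉ S) : ∑ v, charSum Q S v = 0 := by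
  simp only [charSum]
  rw [Finset.sum_comm]
  refine Finset.sum_eq_zero fun x hx => ?_
  simp only [QuadraticMap.polar_comm Q x, h.sum_sgn_polar]
  rw [if_neg]
  rintro rfl; exact h0 hx

/-- Expanding the square and summing over v keeps only the pairs with x = w + y. The case w = 0 is
Parseval. -/
lemma sum_charSum_sq (h : IsMinusType Q) (w : V) :
    ∑ v, charSum Q S v ^ 2 * sgn (B v w) = 256 * #{y ∈ S | w + y ∈ S} := by
  have e : ∀ v, charSum Q S v ^ 2 * sgn (B v w) =
      ∑ y ∈ S, ∑ x ∈ S, sgn (B v (x + (w + y))) := by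
    intro v
    rw [sq, charSum, Finset.sum_mul_sum, Finset.sum_mul]
    refine Finset.sum_congr rfl fun y _ => ?_
    rw [Finset.sum_mul]
    refine Finset.sum_congr rfl fun x _ => ?_
    rw [QuadraticMap.polar_add_right, QuadraticMap.polar_add_right, sgn_add, sgn_add,
      QuadraticMap.polar_comm Q y, QuadraticMap.polar_comm Q x]
    ring
  simp only [e]
  rw [Finset.sum_comm, Finset.card_filter, Nat.cast_sum, Finset.mul_sum]
  refine Finset.sum_congr rfl fun y _ => ?_
  rw [Finset.sum_comm]
  simp only [h.sum_sgn_polar]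
  have : ∀ x, x + (w + y) = 0 ↔ x = w + y := fun x =>
    ⟨eq_of_add_eq_zero, by rintro rfl; exact ZModModule.add_self _⟩
  simp only [this]
  rw [Finset.sum_ite_eq']
  split_ifs <;> simp

lemma card_singular (h : IsMinusType Q) : #{p | p ≠ 0 ∧ Q p = 0} = 119 := by
  have h1 := h.eight_mul_card 0 0 (by simp) (by simp) (by simp)
  simp only [QuadraticMap.polar_zero_right, and_self, and_true, add_zero, if_true] at h1
  have h2 : (univ.filter fun p => p ≠ 0 ∧ Q p = 0) = (univ.filter fun p => Q p = 0).erase 0 := by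
    ext; simp
  rw [h2, Finset.card_erase_of_mem (by simp)]
  omega

end IsMinusType

namespace IsVectorOvoid

omit [Fintype V] in
lemma zero_notMem (hS : IsVectorOvoid Q m S) : 0 ∉ S := fun h0 => (hS.1 0 h0).1 rfl

lemma sum_spansPlane (h : IsMinusType Q) (hS : IsVectorOvoid Q m S) {p y z : V}
    (hs : SpansPlane Q p y z) :
    ind S p + ind S y + ind S z + ind S (p + y) + ind S (p + z) + ind S (y + z) +
      ind S (p + (y + z)) = m := by
  have h1 := hs.sum_range (ind S)
  rw [sum_ite_eq_ind, hS.2 _ (hs.isGenerator h)] at h1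
  have h0 : ind S 0 = 0 := if_neg hS.zero_notMem
  rw [h1, h0, zero_add]

/-- The number of points of an ovoid collinear with a given point. -/
lemma card_collinear (h : IsMinusType Q) (hS : IsVectorOvoid Q m S) {p : V} (hp : Q p = 0)
    (hp0 : p ≠ 0) : (#{y ∈ S | B y p = 0 ∧ y ≠ p} : ℤ) = 9 * (m - ind S p) := by
  -- There are 54 choices of y and 20 of z for each, so the plane count reads 54·20·m =
  -- 20·(54·1_S(p) + 6N), where N is the required number.
  have key : ∀ c : V → ℤ, ∑ y, ∑ z, (if SpansPlane Q p y z then c y else 0) =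
      ∑ y with Q y = 0 ∧ B y p = 0 ∧ y ≠ 0 ∧ y ≠ p, 20 * c y := by
    intro c
    rw [Finset.sum_filter]
    refine Finset.sum_congr rfl fun y _ => ?_
    rw [← Finset.sum_filter, Finset.sum_const, nsmul_eq_mul]
    split_ifs with hy
    · rw [h.card_spansPlane hp hp0 hy]; rfl
    · rw [Finset.filter_false_of_mem]
      · simp
      · exact fun z _ hz => hy ⟨hz.1.2.1, hz.1.2.2.2.1, hz.2.2.1, hz.2.2.2.1⟩
  have h1 := SpansPlane.sum_plane (Q := Q) (ind S) p
  have h2 : ∑ y, ∑ z, (if SpansPlane Q p y z then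
      ind S p + ind S y + ind S z + ind S (p + y) + ind S (p + z) + ind S (y + z) +
        ind S (p + (y + z)) else 0) = ∑ y, ∑ z, if SpansPlane Q p y z then (m : ℤ) else 0 := by
    refine Finset.sum_congr rfl fun y _ => Finset.sum_congr rfl fun z _ => ?_
    split_ifs with hs
    · exact hS.sum_spansPlane h hs
    · rfl
  rw [h2, key fun y => ind S p + 6 * ind S y, key fun _ => (m : ℤ)] at h1
  simp only [mul_add, Finset.sum_add_distrib, Finset.sum_const, h.card_singular_perp hp hp0,
    nsmul_eq_mul, ← Finset.mul_sum, sum_ite_eq_ind] at h1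
  have h3 : (S.filter fun y => Q y = 0 ∧ B y p = 0 ∧ y ≠ 0 ∧ y ≠ p) =
      S.filter fun y => B y p = 0 ∧ y ≠ p := by
    refine Finset.filter_congr fun y hy => ?_
    have := hS.1 y hy
    tauto
  rw [h3] at h1
  push_cast at h1
  linarith

lemma card_eq (h : IsMinusType Q) (hS : IsVectorOvoid Q m S) : (#S : ℤ) = 17 * m := by
  -- Double counting of collinear pairs: 9(119m - |S|) = 54|S|.
  have h1 : ∑ p with p ≠ 0 ∧ Q p = 0, (#{y ∈ S | B y p = 0 ∧ y ≠ p} : ℤ) =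
      ∑ p with p ≠ 0 ∧ Q p = 0, 9 * (m - ind S p) :=
    Finset.sum_congr rfl fun p hp => by
      simp only [mem_filter, mem_univ, true_and] at hp
      exact hS.card_collinear h hp.2 hp.1
  have h2 : ∑ p with p ≠ 0 ∧ Q p = 0, (#{y ∈ S | B y p = 0 ∧ y ≠ p} : ℤ) =
      ∑ y ∈ S, 54 := by
    simp only [Finset.card_filter, Nat.cast_sum]
    rw [Finset.sum_comm]
    refine Finset.sum_congr rfl fun y hy => ?_
    rw [← Nat.cast_sum, ← Finset.card_filter, Finset.filter_filter]
    refine Eq.trans (congrArg Nat.cast (congrArg Finset.card ?_))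
      (congrArg Nat.cast (h.card_singular_perp (hS.1 y hy).2 (hS.1 y hy).1))
    ext p
    simp only [mem_filter, mem_univ, true_and, QuadraticMap.polar_comm Q y p]
    constructor
    · rintro ⟨⟨a, b⟩, c, d⟩; exact ⟨b, c, a, d.symm⟩
    · rintro ⟨b, c, a, d⟩; exact ⟨⟨a, b⟩, c, d.symm⟩
  have h3 : (S.filter fun p => p ≠ 0 ∧ Q p = 0) = S :=
    Finset.filter_true_of_mem hS.1
  rw [h2, ← Finset.mul_sum, Finset.sum_sub_distrib, sum_ite_eq_ind, h3, Finset.sum_const,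
    Finset.sum_const, h.card_singular] at h1
  simp only [nsmul_eq_mul] at h1
  push_cast at h1
  linarith

lemma charSum_of_singular (h : IsMinusType Q) (hS : IsVectorOvoid Q m S) {p : V} (hp : Q p = 0)
    (hp0 : p ≠ 0) : charSum Q S p = m - 16 * ind S p := by
  have h1 := card_add_charSum (Q := Q) (S := S) p
  have h2 := hS.card_collinear h hp hp0
  have h3 := hS.card_eq h
  have h4 : (#{x ∈ S | B x p = 0} : ℤ) = #{y ∈ S | B y p = 0 ∧ y ≠ p} + ind S p := by
    rw [Finset.card_filter, Finset.card_filter, Nat.cast_sum, Nat.cast_sum, ind,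
      ← Finset.sum_ite_eq' S p (fun _ => (1 : ℤ)), ← Finset.sum_add_distrib]
    refine Finset.sum_congr rfl fun x _ => ?_
    by_cases hx : x = p
    · subst hx; simp [polar_self_eq_zero Q x]
    · simp [hx]
  linarith

omit [AddCommGroup V] [Module (ZMod 2) V] [Fintype V] in
lemma ind_sq (x : V) : ind S x ^ 2 = ind S x := by
  unfold ind; split_ifs <;> simp

omit [AddCommGroup V] [Module (ZMod 2) V] in
lemma sum_ind_mul (F : V → ℤ) : ∑ x, ind S x * F x = ∑ x ∈ S, F x := by
  simp [ind]

/-- The differences of the two sides, corrected at v = 0, sum to zero by Parseval. They vanish at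
singular v and are squares at nonsingular v, so all of them vanish. -/
lemma charSum_eq (h : IsMinusType Q) (hS : IsVectorOvoid Q m S) {v : V} (hv : v ≠ 0) :
    (charSum Q S v - m) ^ 2 = 256 * ind S v := by
  have hsum : ∑ v, ((charSum Q S v - m) ^ 2 - 256 * ind S v - if v = 0 then 256 * (m : ℤ) ^ 2
      else 0) = 0 := by
    have h1 := h.sum_charSum_sq (S := S) 0
    simp only [QuadraticMap.polar_zero_right, sgn_zero, mul_one, zero_add,
      Finset.filter_mem_eq_inter, Finset.inter_self, hS.card_eq h] at h1
    have h2 := h.sum_charSum hS.zero_notMem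
    have h3 := sum_ind_mul (S := S) fun _ => 1
    simp only [mul_one, Finset.sum_const, nsmul_eq_mul, hS.card_eq h] at h3
    simp only [sub_sq, Finset.sum_sub_distrib, Finset.sum_add_distrib, h1, ← Finset.mul_sum,
      ← Finset.sum_mul, h2, h3]
    simp [h.card]
  have hnn : ∀ v ∈ univ, 0 ≤ (charSum Q S v - m) ^ 2 - 256 * ind S v -
      if v = 0 then 256 * (m : ℤ) ^ 2 else 0 := by
    intro v _
    by_cases hv : v = 0
    · subst hv
      rw [charSum_zero, hS.card_eq h, ind, if_neg hS.zero_notMem, if_pos rfl]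
      apply le_of_eq; ring
    · rw [if_neg hv]
      by_cases hq : Q v = 0
      · rw [hS.charSum_of_singular h hq hv]
        apply le_of_eq
        linear_combination (-256) * ind_sq (S := S) v
      · have : v ∉ S := fun hvS => hq (hS.1 v hvS).2
        rw [ind, if_neg this]
        simpa using sq_nonneg _
  have := (Finset.sum_eq_zero_iff_of_nonneg hnn).1 hsum v (mem_univ v)
  rw [if_neg hv] at this
  linarith

lemma charSum_of_ne_zero (h : IsMinusType Q) (hS : IsVectorOvoid Q m S) {v : V} (hv : v ≠ 0) :
    charSum Q S v = m - 16 * ind S v := by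
  by_cases hq : Q v = 0
  · exact hS.charSum_of_singular h hq hv
  · have h1 := hS.charSum_eq h hv
    have : v ∉ S := fun hvS => hq (hS.1 v hvS).2
    rw [ind, if_neg this] at h1 ⊢
    have := pow_eq_zero_iff (two_ne_zero) |>.1 (h1.trans (mul_zero _))
    linarith

/-- The number of lines through a point of an ovoid that are contained in the ovoid, doubled. -/
lemma card_lines (h : IsMinusType Q) (hS : IsVectorOvoid Q m S) {w : V} (hw : w ∈ S) :
    (#{y ∈ S | w + y ∈ S} : ℤ) = m ^ 2 + 3 * m - 16 := by
  have h1 := h.sum_charSum_sq (S := S) w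
  -- The coefficients are 256 - 32m = (m - 16)² - m² and 288m² = (17m)² - m².
  have e : ∀ v, charSum Q S v ^ 2 * sgn (B v w) = (m : ℤ) ^ 2 * sgn (B v w) +
      (256 - 32 * m) * (ind S v * sgn (B v w)) + if v = 0 then 288 * (m : ℤ) ^ 2 else 0 := by
    intro v
    split_ifs with hv
    · subst hv
      rw [charSum_zero, hS.card_eq h, ind, if_neg hS.zero_notMem, QuadraticMap.polar_zero_left,
        sgn_zero]
      ring
    · rw [hS.charSum_of_ne_zero h hv]
      linear_combination 256 * sgn (B v w) * ind_sq (S := S) v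
  have h2 := hS.charSum_of_ne_zero h (hS.1 w hw).1
  rw [ind, if_pos hw, charSum] at h2
  simp only [e, Finset.sum_add_distrib, ← Finset.mul_sum, sum_ind_mul, h.sum_sgn_polar, h2,
    (hS.1 w hw).1, if_false, Finset.sum_ite_eq', mem_univ, if_true] at h1
  linarith

lemma three_le (h : IsMinusType Q) (hS : IsVectorOvoid Q m S) (hne : S.Nonempty) : 3 ≤ m := by
  obtain ⟨w, hw⟩ := hne
  have h1 := hS.card_lines h hw
  by_contra! hm
  -- For m = 0, 1, 2 the cardinality would be -16, -12, -6.
  interval_cases m <;> norm_num at h1 <;> omega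

/-- J makes V a space over F_4, and the hypotheses make Q the trace of an F_4-valued quadratic form.
Such a value is zero once two of its three trace components Q x, Q (J x), Q (J (J x)) vanish. -/
lemma of_cubeRoot (h : IsMinusType Q) (J : V →ₗ[ZMod 2] V)
    (hJJ : ∀ x, J (J x) = J x + x) (hQJ : ∀ x, Q (J (J x)) = Q (J x) + Q x)
    (hBJ : ∀ x y, B (J x) y = B x (J y)) :
    IsVectorOvoid Q 3 (univ.filter fun x => x ≠ 0 ∧ Q x = 0 ∧ Q (J x) = 0) := by
  set S := univ.filter fun x => x ≠ 0 ∧ Q x = 0 ∧ Q (J x) = 0 with hSdef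
  have hJ3 : ∀ x, J (J (J x)) = x := by
    intro x
    rw [hJJ (J x), hJJ x, add_comm, add_add_cancel_self]
  -- Substituting J x for x moves J to the other argument of B, by self-adjointness and J³ = 1.
  have gauss_comp : ∀ v, ∑ x, sgn (Q (J x)) * sgn (B x v) = -16 * sgn (Q (J (J v))) := by
    intro v
    let e : V ≃ V := ⟨J, fun x => J (J x), hJ3, hJ3⟩
    rw [← h.sum_sgn_mul_sgn_polar,
      ← Equiv.sum_comp e fun x => sgn (Q x) * sgn (B x (J (J v)))]
    refine Finset.sum_congr rfl fun x _ => ?_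
    change _ = sgn (Q (J x)) * sgn (B (J x) _)
    rw [hBJ, hJ3]
  have gauss_comp2 : ∀ v, ∑ x, sgn (Q (J (J x))) * sgn (B x v) = -16 * sgn (Q (J v)) := by
    intro v
    let e : V ≃ V := ⟨fun x => J (J x), J, hJ3, hJ3⟩
    rw [← h.sum_sgn_mul_sgn_polar, ← Equiv.sum_comp e fun x => sgn (Q x) * sgn (B x (J v))]
    refine Finset.sum_congr rfl fun x _ => ?_
    change _ = sgn (Q (J (J x))) * sgn (B (J (J x)) _)
    rw [hBJ, hBJ, hJ3]
  have hchar : ∀ v, charSum Q S v = (if v = 0 then 64 else 0) -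
      4 * (sgn (Q v) + sgn (Q (J v)) + sgn (Q (J (J v)))) - 1 := by
    intro v
    have h1 : 4 * (charSum Q S v + 1) = ∑ x, (sgn (B x v) + sgn (Q x) * sgn (B x v) +
        sgn (Q (J x)) * sgn (B x v) + sgn (Q (J (J x))) * sgn (B x v)) := by
      have h2 : charSum Q S v + 1 =
          ∑ x, if Q x = 0 ∧ Q (J x) = 0 then sgn (B x v) else 0 := by
        rw [charSum, hSdef, Finset.sum_filter,
          show (1 : ℤ) = ∑ x : V, if x = 0 then 1 else 0 by simp, ← Finset.sum_add_distrib]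
        refine Finset.sum_congr rfl fun x _ => ?_
        by_cases hx : x = 0
        · subst hx; simp
        · simp [hx]
      rw [h2, Finset.mul_sum]
      refine Finset.sum_congr rfl fun x _ => ?_
      have h3 : (1 + sgn (Q x)) * (1 + sgn (Q (J x))) =
          1 + sgn (Q x) + sgn (Q (J x)) + sgn (Q (J (J x))) := by
        rw [hQJ, sgn_add]; ring
      have h6 : sgn (B x v) + sgn (Q x) * sgn (B x v) + sgn (Q (J x)) * sgn (B x v) +
          sgn (Q (J (J x))) * sgn (B x v) =
          (1 + sgn (Q x)) * (1 + sgn (Q (J x))) * sgn (B x v) := by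
        rw [h3]; ring
      rw [h6, one_add_sgn, one_add_sgn]
      by_cases h4 : Q x = 0 <;> by_cases h5 : Q (J x) = 0 <;> simp [h4, h5]
    simp only [Finset.sum_add_distrib, h.sum_sgn_polar, h.sum_sgn_mul_sgn_polar, gauss_comp,
      gauss_comp2] at h1
    split_ifs at h1 ⊢ <;> linarith
  refine ⟨fun x hx => ?_, fun W hW => ?_⟩
  · simp only [hSdef, mem_filter, mem_univ, true_and] at hx
    exact ⟨hx.1, hx.2.1⟩
  -- With c = |S ∩ W|, Poisson summation over W becomes 8c = 24 - 16c + 48, so c = 3.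
  · have h1 := sum_mem_sum_mul_sgn_polar (Q := Q) W (ind S)
    have h2 : ∑ x, (if ∀ u ∈ W, B x u = 0 then ind S x else 0) = #{x ∈ S | x ∈ W} := by
      rw [← Finset.sum_filter, sum_ite_eq_ind]
      congr 2
      refine Finset.filter_congr fun x hx => ?_
      simp only [hSdef, mem_filter, mem_univ, true_and] at hx
      exact ⟨hW.mem_of_perp hx.2.1, fun hxW u hu => hW.1.polar_eq_zero hxW hu⟩
    have h3 : ∀ u ∈ univ.filter (· ∈ W), ∑ x, ind S x * sgn (B x u) =
        3 - 16 * ind S u + if u = 0 then 48 else 0 := by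
      intro u hu
      have hq : Q u = 0 := hW.1 u (by simpa using hu)
      rw [sum_ind_mul, ← charSum, hchar, ind, hQJ, hq]
      by_cases hu0 : u = 0
      · subst hu0; simp [hSdef]
      · by_cases hj : Q (J u) = 0
        · simp [hSdef, hu0, hq, hj]
        · simp [hSdef, hu0, hq, hj, sgn_of_ne_zero hj]
    rw [Finset.sum_congr rfl h3, h2, h.card_of_isGenerator hW] at h1
    simp only [Finset.sum_add_distrib, Finset.sum_sub_distrib, ← Finset.mul_sum, sum_ite_eq_ind,
      Finset.sum_const, h.card_of_isGenerator hW] at h1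
    rw [Finset.sum_ite_eq' _ (0 : V), if_pos (by simp)] at h1
    norm_num at h1
    omega

end IsVectorOvoid

end VectorOvoids

/-! ### The standard form and its structure over F_4. -/

/-- The standard elliptic form in eight variables over the field with two elements. -/
def standardForm (x : Fin 8 → ZMod 2) : ZMod 2 :=
  x 0 * x 1 + x 2 * x 3 + x 4 * x 5 + (x 6 * x 6 + x 6 * x 7 + x 7 * x 7)

/-- Multiplication by a primitive cube root of unity, for a suitable structure of vector space
over the field with four elements. -/
def cubeRoot : (Fin 8 → ZMod 2) →ₗ[ZMod 2] (Fin 8 → ZMod 2) where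
  toFun x := ![x 2, x 3, x 0 + x 2, x 1 + x 3, x 6, x 6 + x 7, x 4 + x 6, x 4 + x 5 + x 7]
  map_add' x y := by
    ext i; fin_cases i <;> simp <;> ring
  map_smul' c x := by
    ext i; fin_cases i <;> simp <;> ring

lemma cubeRoot_apply (x : Fin 8 → ZMod 2) : cubeRoot x =
    ![x 2, x 3, x 0 + x 2, x 1 + x 3, x 6, x 6 + x 7, x 4 + x 6, x 4 + x 5 + x 7] := rfl

lemma cubeRoot_cubeRoot (x : Fin 8 → ZMod 2) : cubeRoot (cubeRoot x) = cubeRoot x + x := by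
  ext i
  fin_cases i <;> simp [cubeRoot_apply] <;> grind

lemma standardForm_cubeRoot (x : Fin 8 → ZMod 2) :
    standardForm (cubeRoot (cubeRoot x)) = standardForm (cubeRoot x) + standardForm x := by
  simp [cubeRoot_apply, standardForm]
  grind

lemma polar_cubeRoot (x y : Fin 8 → ZMod 2) :
    QuadraticMap.polar standardForm (cubeRoot x) y =
      QuadraticMap.polar standardForm x (cubeRoot y) := by
  simp [cubeRoot_apply, standardForm, QuadraticMap.polar]
  grind

lemma sum_sgn_standardForm : ∑ x, sgn (standardForm x) = -16 := by
  decide +kernel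

lemma standardForm_nondegenerate (x : Fin 8 → ZMod 2)
    (h : ∀ y, QuadraticMap.polar standardForm y x = 0) : x = 0 := by
  ext i
  -- Each coordinate is isolated by pairing with the other basis vector of its pair {0,1}, {2,3},
  -- {4,5}, {6,7}.
  fin_cases i
  · have := h (Pi.single 1 1)
    simp [QuadraticMap.polar, standardForm] at this ⊢; grind
  · have := h (Pi.single 0 1)
    simp [QuadraticMap.polar, standardForm] at this ⊢; grind
  · have := h (Pi.single 3 1)
    simp [QuadraticMap.polar, standardForm] at this ⊢; grind
  · have := h (Pi.single 2 1)
    simp [QuadraticMap.polar, standardForm] at this ⊢; grind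
  · have := h (Pi.single 5 1)
    simp [QuadraticMap.polar, standardForm] at this ⊢; grind
  · have := h (Pi.single 4 1)
    simp [QuadraticMap.polar, standardForm] at this ⊢; grind
  · have := h (Pi.single 7 1)
    simp [QuadraticMap.polar, standardForm] at this ⊢; grind
  · have := h (Pi.single 6 1)
    simp [QuadraticMap.polar, standardForm] at this ⊢; grind

open MvPolynomial in
lemma eq_of_isHomogeneous_two {g : MvPolynomial (Fin 2) (ZMod 2)} (hg : g.IsHomogeneous 2) :
    ∃ α β γ : ZMod 2, g = C α * X 0 ^ 2 + C β * (X 0 * X 1) + C γ * X 1 ^ 2 := by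
  refine ⟨g.coeff (Finsupp.single 0 2), g.coeff (Finsupp.single 0 1 + Finsupp.single 1 1),
    g.coeff (Finsupp.single 1 2), ?_⟩
  have e : ∀ a b c : ZMod 2, C a * X 0 ^ 2 + C b * (X 0 * X 1) + C c * X 1 ^ 2 =
      monomial (Finsupp.single (0 : Fin 2) 2) a +
        monomial (Finsupp.single 0 1 + Finsupp.single 1 1) b +
        monomial (Finsupp.single 1 2) c := by
    intro a b c
    rw [X_pow_eq_monomial, X_pow_eq_monomial, X, X, monomial_mul, C_mul_monomial, C_mul_monomial,
      C_mul_monomial]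
    simp
  rw [e]
  ext m
  simp only [coeff_add, coeff_monomial]
  by_cases hm : m 0 + m 1 = 2
  · have h3 : m = Finsupp.single 0 2 ∨ m = Finsupp.single 0 1 + Finsupp.single 1 1 ∨
        m = Finsupp.single 1 2 := by
      have : m 0 = 2 ∧ m 1 = 0 ∨ m 0 = 1 ∧ m 1 = 1 ∨ m 0 = 0 ∧ m 1 = 2 := by omega
      rcases this with ⟨h0, h1⟩ | ⟨h0, h1⟩ | ⟨h0, h1⟩
      · left; ext i; fin_cases i <;> simp [h0, h1]
      · right; left; ext i; fin_cases i <;> simp [h0, h1]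
      · right; right; ext i; fin_cases i <;> simp [h0, h1]
    rcases h3 with rfl | rfl | rfl <;> simp [Finsupp.ext_iff]
  · rw [hg.coeff_eq_zero (by rwa [Finsupp.degree_eq_sum, Fin.sum_univ_two])]
    rw [if_neg, if_neg, if_neg]
    · simp
    all_goals rintro rfl; simp at hm

open MvPolynomial in
lemma not_isUnit_of_eval_eq_zero {σ : Type*} {f : MvPolynomial σ (ZMod 2)} (x : σ → ZMod 2)
    (h : eval x f = 0) : ¬ IsUnit f := fun hu => by
  have := hu.map (eval x)
  rw [h] at this
  exact not_isUnit_zero this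

open MvPolynomial in
/-- The only irreducible binary quadratic form over the field with two elements. -/
lemma eval_of_irreducible {g : MvPolynomial (Fin 2) (ZMod 2)} (hg : g.IsHomogeneous 2)
    (hirr : Irreducible g) (a b : ZMod 2) :
    eval ![a, b] g = a * a + a * b + b * b := by
  obtain ⟨α, β, γ, rfl⟩ := eq_of_isHomogeneous_two hg
  have key : ∀ f₁ f₂ : MvPolynomial (Fin 2) (ZMod 2), eval 0 f₁ = 0 → eval 0 f₂ = 0 →
      C α * X 0 ^ 2 + C β * (X 0 * X 1) + C γ * X 1 ^ 2 ≠ f₁ * f₂ := fun f₁ f₂ h₁ h₂ h =>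
    (hirr.isUnit_or_isUnit h).elim (not_isUnit_of_eval_eq_zero _ h₁)
      (not_isUnit_of_eval_eq_zero _ h₂)
  have zo : ∀ c : ZMod 2, c = 0 ∨ c = 1 := by decide
  -- A zero coefficient gives a factorization: by X 1 if α = 0, by X 0 if γ = 0, and as (X 0 + X 1)²
  -- if β = 0.
  rcases zo α with rfl | rfl
  · exact absurd (by simp; ring) (key (X 1) (C β * X 0 + C γ * X 1) (by simp) (by simp))
  rcases zo γ with rfl | rfl
  · exact absurd (by simp; ring) (key (X 0) (X 0 + C β * X 1) (by simp) (by simp))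
  rcases zo β with rfl | rfl
  · exact absurd (by simp; grind) (key (X 0 + X 1) (X 0 + X 1) (by simp) (by simp))
  have sq : ∀ c : ZMod 2, c ^ 2 = c * c := fun c => pow_two c
  simp only [map_add, map_mul, map_pow, eval_C, eval_X, one_mul, sq]
  rfl

/-! ### From projective points to nonzero vectors; complements. -/

section Transfer

variable {V : Type*} [AddCommGroup V] [Module (ZMod 2) V] {Q : QuadraticForm (ZMod 2) V}

lemma exists_equiv_standardForm (hQ : IsElliptic 3 Q) :
    ∃ e : V ≃ₗ[ZMod 2] (Fin 8 → ZMod 2), ∀ v, Q v = standardForm (e v) := by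
  obtain ⟨b, g, hg, hirr, hb⟩ := hQ
  refine ⟨b.equivFun, fun v => ?_⟩
  rw [hb, eval_of_irreducible hg hirr, Fin.sum_univ_three]
  rfl

lemma isMinusType_of_equiv [Fintype V] (e : V ≃ₗ[ZMod 2] (Fin 8 → ZMod 2))
    (he : ∀ v, Q v = standardForm (e v)) : IsMinusType Q where
  card := by
    rw [Fintype.card_congr e.toEquiv]; simp
  nondegenerate x hx := by
    have h0 : e x = 0 := standardForm_nondegenerate _ fun y => by
      have := hx (e.symm y)
      simpa [QuadraticMap.polar, he] using this
    simpa using h0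
  gauss := by
    rw [← sum_sgn_standardForm, ← Equiv.sum_comp e.toEquiv]
    exact Finset.sum_congr rfl fun x _ => by rw [he]; rfl

open scoped Classical in
lemma exists_isVectorOvoid_three [Fintype V] (e : V ≃ₗ[ZMod 2] (Fin 8 → ZMod 2))
    (he : ∀ v, Q v = standardForm (e v)) : ∃ S : Finset V, IsVectorOvoid Q 3 S := by
  refine ⟨_, IsVectorOvoid.of_cubeRoot (isMinusType_of_equiv e he)
    (e.symm.toLinearMap ∘ₗ cubeRoot ∘ₗ e.toLinearMap) (fun x => ?_) (fun x => ?_)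
    (fun x y => ?_)⟩
  · apply e.injective
    simp [cubeRoot_cubeRoot]
  · simp [he, standardForm_cubeRoot]
  · simpa [QuadraticMap.polar, he] using polar_cubeRoot (e x) (e y)

/-- The only unit of F_2 is 1, so a point has a single representative. -/
lemma rep_mk {v : V} (hv : v ≠ 0) : (Projectivization.mk (ZMod 2) v hv).rep = v := by
  obtain ⟨a, ha⟩ := Projectivization.exists_smul_eq_mk_rep (ZMod 2) v hv
  have h1 : ∀ a : (ZMod 2)ˣ, a = 1 := by decide
  rw [← ha, h1 a, one_smul]

lemma rep_injective :
    Function.Injective (Projectivization.rep : Projectivization (ZMod 2) V → V) := by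
  intro P P' h
  rw [← P.mk_rep, ← P'.mk_rep]
  simp only [h]

lemma mem_pointsOf {P : Projectivization (ZMod 2) V} {W : Submodule (ZMod 2) V} :
    P ∈ pointsOf W ↔ P.rep ∈ W := by
  rw [pointsOf, Set.mem_ofPred_eq, Projectivization.submodule_eq,
    Submodule.span_singleton_le_iff_mem]

lemma mem_quadricPoints {P : Projectivization (ZMod 2) V} :
    P ∈ quadricPoints Q ↔ Q P.rep = 0 := by
  rw [quadricPoints, Set.mem_ofPred_eq, Projectivization.submodule_eq]
  refine ⟨fun h => h _ (Submodule.mem_span_singleton_self _), fun h w hw => ?_⟩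
  obtain ⟨c, rfl⟩ := Submodule.mem_span_singleton.1 hw
  rw [QuadraticMap.map_smul, h, smul_zero]

variable [Fintype V]

open scoped Classical in
/-- The nonzero vectors representing a set of points. -/
noncomputable def vectors (O : Set (Projectivization (ZMod 2) V)) : Finset V :=
  univ.filter fun x => ∃ P ∈ O, P.rep = x

lemma mem_vectors {O : Set (Projectivization (ZMod 2) V)} {x : V} :
    x ∈ vectors O ↔ ∃ P ∈ O, P.rep = x := by
  simp [vectors]

lemma rep_mem_vectors {O : Set (Projectivization (ZMod 2) V)} {P : Projectivization (ZMod 2) V} :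
    P.rep ∈ vectors O ↔ P ∈ O := by
  rw [mem_vectors]
  exact ⟨fun ⟨P', h, e⟩ => rep_injective e ▸ h, fun h => ⟨P, h, rfl⟩⟩

open scoped Classical in
lemma ncard_inter_pointsOf (O : Set (Projectivization (ZMod 2) V)) (W : Submodule (ZMod 2) V) :
    (O ∩ pointsOf W).ncard = #{x ∈ vectors O | x ∈ W} := by
  rw [← Set.ncard_coe_finset, ← Set.ncard_image_of_injective _ rep_injective]
  congr 1
  ext x
  simp only [Set.mem_image, Set.mem_inter_iff, mem_pointsOf, coe_filter, Set.mem_ofPred_eq,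
    mem_vectors]
  constructor
  · rintro ⟨P, ⟨h1, h2⟩, rfl⟩; exact ⟨⟨P, h1, rfl⟩, h2⟩
  · rintro ⟨⟨P, h1, rfl⟩, h2⟩; exact ⟨P, ⟨h1, h2⟩, rfl⟩

lemma isOvoid_iff {m : ℕ} {O : Set (Projectivization (ZMod 2) V)} :
    IsOvoid Q m O ↔ IsVectorOvoid Q m (vectors O) := by
  classical
  refine and_congr ?_ (forall₂_congr fun W _ => ?_)
  · constructor
    · intro h x hx
      obtain ⟨P, hP, rfl⟩ := mem_vectors.1 hx
      exact ⟨P.rep_nonzero, mem_quadricPoints.1 (h hP)⟩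
    · intro h P hP
      exact mem_quadricPoints.2 (h _ (rep_mem_vectors.2 hP)).2
  · rw [ncard_inter_pointsOf]

lemma vectors_of_finset {S : Finset V} (hS : 0 ∉ S) :
    vectors {P : Projectivization (ZMod 2) V | P.rep ∈ S} = S := by
  ext x
  rw [mem_vectors]
  constructor
  · rintro ⟨P, hP, rfl⟩; exact hP
  · intro hx
    have hx0 : x ≠ 0 := by rintro rfl; exact hS hx
    exact ⟨Projectivization.mk _ x hx0, by rwa [Set.mem_ofPred_eq, rep_mk], rep_mk hx0⟩

lemma IsMinusType.isOvoid_quadricPoints (h : IsMinusType Q) :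
    IsOvoid Q 7 (quadricPoints Q) := by
  classical
  refine ⟨subset_rfl, fun W hW => ?_⟩
  rw [ncard_inter_pointsOf]
  have e : (vectors (quadricPoints Q)).filter (· ∈ W) = (univ.filter (· ∈ W)).erase 0 := by
    ext x
    simp only [mem_filter, mem_vectors, mem_erase, mem_univ, true_and]
    constructor
    · rintro ⟨⟨P, hP, rfl⟩, hx⟩; exact ⟨P.rep_nonzero, hx⟩
    · rintro ⟨hx0, hx⟩
      refine ⟨⟨Projectivization.mk _ x hx0, ?_, rep_mk hx0⟩, hx⟩
      rw [mem_quadricPoints, rep_mk, hW.1 x hx]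
  rw [e, Finset.card_erase_of_mem (by simp)]
  have := h.card_of_isGenerator hW
  have e2 : #{u | u ∈ W} = 8 := by convert this
  rw [e2]

/-- The truncated subtraction is harmless: O lies in the quadric, and a generator has 7 points. -/
lemma IsMinusType.isOvoid_compl (h : IsMinusType Q) {m : ℕ}
    {O : Set (Projectivization (ZMod 2) V)} (hO : IsOvoid Q m O) :
    IsOvoid Q (7 - m) (quadricPoints Q \ O) := by
  refine ⟨Set.sdiff_subset, fun W hW => ?_⟩
  have e : (quadricPoints Q \ O) ∩ pointsOf W =
      (quadricPoints Q ∩ pointsOf W) \ (O ∩ pointsOf W) := by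
    ext P; simp; tauto
  rw [e, Set.ncard_sdiff (Set.inter_subset_inter_left _ hO.1) (Set.toFinite _),
    h.isOvoid_quadricPoints.2 W hW, hO.2 W hW]

lemma IsMinusType.three_le_of_isOvoid (h : IsMinusType Q) {m : ℕ}
    {O : Set (Projectivization (ZMod 2) V)} (hO : IsOvoid Q m O) (hne : O.Nonempty) : 3 ≤ m := by
  obtain ⟨P, hP⟩ := hne
  exact (isOvoid_iff.1 hO).three_le h ⟨_, rep_mem_vectors.2 hP⟩

lemma IsMinusType.not_isTrivialOvoid (h : IsMinusType Q) {m : ℕ}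
    {O : Set (Projectivization (ZMod 2) V)} (hO : IsOvoid Q m O) (h0 : m ≠ 0) (h7 : m ≠ 7) :
    ¬ IsTrivialOvoid Q O := by
  obtain ⟨W, hW⟩ := exists_isGenerator (Q := Q)
  have h1 := hO.2 W hW
  rintro (rfl | rfl)
  · simp at h1; exact h0 h1.symm
  · exact h7 (h1.symm.trans (h.isOvoid_quadricPoints.2 W hW))

end Transfer

/-! ### The 1-system carried by a 3-ovoid. -/

section Lines

variable {V : Type*} [AddCommGroup V] [Module (ZMod 2) V] [Fintype V]
  {Q : QuadraticForm (ZMod 2) V} {S : Finset V}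

open scoped Classical

lemma card_of_finrank_eq {W : Submodule (ZMod 2) V} {k : ℕ}
    (hW : Module.finrank (ZMod 2) W = k) : #{u | u ∈ W} = 2 ^ k := by
  have := Module.card_eq_pow_finrank (K := ZMod 2) (V := W)
  rw [hW, ZMod.card, Fintype.card_subtype] at this
  exact this

namespace IsVectorOvoid

lemma card_lines_eq_two (h : IsMinusType Q) (hS : IsVectorOvoid Q 3 S) {x : V} (hx : x ∈ S) :
    #{y ∈ S | x + y ∈ S} = 2 := by
  have := hS.card_lines h hx
  norm_num at this
  omega

/-- The two further points of W are among the two vectors counted by `card_lines_eq_two`, so x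
determines W. -/
lemma line_eq (h : IsMinusType Q) (hS : IsVectorOvoid Q 3 S) {W : Submodule (ZMod 2) V}
    (hW : Module.finrank (ZMod 2) W = 2) (hWS : ∀ w ∈ W, w ≠ 0 → w ∈ S) {x : V} (hx : x ∈ S)
    (hxW : x ∈ W) : (univ.filter (· ∈ W)) \ {0, x} = S.filter fun y => x + y ∈ S := by
  have hx0 := (hS.1 x hx).1
  refine Finset.eq_of_subset_of_card_le (fun y hy => ?_) ?_
  · simp only [mem_sdiff, mem_filter, mem_univ, true_and, mem_insert, mem_singleton,
      not_or] at hy ⊢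
    exact ⟨hWS y hy.1 hy.2.1, hWS _ (W.add_mem hxW hy.1)
      fun hc => hy.2.2 (eq_of_add_eq_zero hc).symm⟩
  · rw [hS.card_lines_eq_two h hx, Finset.card_sdiff_of_subset, card_of_finrank_eq hW,
      Finset.card_pair hx0.symm]
    · norm_num
    · intro y hy
      simp only [mem_insert, mem_singleton] at hy
      rcases hy with rfl | rfl
      · simp
      · simpa using hxW

lemma line_unique (h : IsMinusType Q) (hS : IsVectorOvoid Q 3 S) {W W' : Submodule (ZMod 2) V}
    (hW : Module.finrank (ZMod 2) W = 2) (hWS : ∀ w ∈ W, w ≠ 0 → w ∈ S)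
    (hW' : Module.finrank (ZMod 2) W' = 2) (hWS' : ∀ w ∈ W', w ≠ 0 → w ∈ S)
    {x : V} (hx0 : x ≠ 0) (hxW : x ∈ W) (hxW' : x ∈ W') : W = W' := by
  have hx := hWS x hxW hx0
  have e := (hS.line_eq h hW hWS hx hxW).trans (hS.line_eq h hW' hWS' hx hxW').symm
  ext y
  by_cases hy0 : y = 0
  · subst hy0; simp
  by_cases hyx : y = x
  · subst hyx; simp [hxW, hxW']
  have := Finset.ext_iff.1 e y
  simpa [hy0, hyx] using this

lemma exists_line (h : IsMinusType Q) (hS : IsVectorOvoid Q 3 S) {x : V} (hx : x ∈ S) :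
    ∃ W : Submodule (ZMod 2) V, IsLine Q W ∧ (∀ w ∈ W, w ≠ 0 → w ∈ S) ∧ x ∈ W := by
  obtain ⟨y, hy⟩ : (S.filter fun y => x + y ∈ S).Nonempty := by
    rw [← Finset.card_pos, hS.card_lines_eq_two h hx]; norm_num
  obtain ⟨hy, hxy⟩ := Finset.mem_filter.1 hy
  let f : (ZMod 2 × ZMod 2) →ₗ[ZMod 2] V :=
    (LinearMap.toSpanSingleton (ZMod 2) V x).coprod (LinearMap.toSpanSingleton (ZMod 2) V y)
  have hf : ∀ a b, f (a, b) = a • x + b • y := fun a b => by simp [f]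
  have hmem : ∀ a b, (a, b) ≠ 0 → f (a, b) ∈ S := by
    intro a b hab
    rw [hf]
    rcases zmod_two_eq_zero_or_one a with rfl | rfl <;>
    rcases zmod_two_eq_zero_or_one b with rfl | rfl <;>
    simp only [zero_smul, one_smul, zero_add, add_zero, hx, hy, hxy]
    exact absurd rfl hab
  have hinj : Function.Injective f := by
    rw [injective_iff_map_eq_zero]
    rintro ⟨a, b⟩ h0
    by_contra hab
    exact hS.zero_notMem (h0 ▸ hmem a b hab)
  refine ⟨LinearMap.range f, ⟨?_, ?_⟩, ?_, ⟨(1, 0), by simp [hf]⟩⟩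
  · rintro _ ⟨⟨a, b⟩, rfl⟩
    by_cases hab : (a, b) = 0
    · rw [hab, map_zero, QuadraticMap.map_zero]
    · exact (hS.1 _ (hmem a b hab)).2
  · rw [LinearMap.finrank_range_of_inj hinj]
    simp
  · rintro _ ⟨⟨a, b⟩, rfl⟩ h0
    exact hmem a b fun hc => h0 (by rw [hc, map_zero])

/-- The number of lines contained in a `3`-ovoid. -/
lemma card_filter_lines (h : IsMinusType Q) (hS : IsVectorOvoid Q 3 S) :
    #{W : Submodule (ZMod 2) V | IsLine Q W ∧ ∀ w ∈ W, w ≠ 0 → w ∈ S} = 17 := by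
  set L : Finset (Submodule (ZMod 2) V) :=
    univ.filter fun W => IsLine Q W ∧ ∀ w ∈ W, w ≠ 0 → w ∈ S with hL
  have e : S = L.biUnion fun W => (univ.filter (· ∈ W)).erase 0 := by
    ext x
    simp only [hL, mem_biUnion, mem_filter, mem_univ, true_and, mem_erase]
    constructor
    · intro hx
      obtain ⟨W, h1, h2, h3⟩ := hS.exists_line h hx
      exact ⟨W, ⟨h1, h2⟩, (hS.1 x hx).1, h3⟩
    · rintro ⟨W, ⟨-, h2⟩, h3, h4⟩
      exact h2 x h4 h3
  -- The lines partition S, so 3·|L| = 17·3.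
  have h1 : #S = ∑ W ∈ L, 3 := by
    conv_lhs => rw [e]
    rw [Finset.card_biUnion]
    · refine Finset.sum_congr rfl fun W hW => ?_
      simp only [hL, mem_filter, mem_univ, true_and] at hW
      rw [Finset.card_erase_of_mem (by simp), card_of_finrank_eq hW.1.2]
      norm_num
    · intro W hW W' hW' hne
      simp only [hL, coe_filter, mem_univ, true_and, Set.mem_ofPred_eq] at hW hW'
      rw [Function.onFun, Finset.disjoint_left]
      intro x hx hx'
      simp only [mem_filter, mem_univ, true_and, mem_erase] at hx hx'
      exact hne (hS.line_unique h hW.1.2 hW.2 hW'.1.2 hW'.2 hx.1 hx.2 hx'.2)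
  have h2 := hS.card_eq h
  rw [Finset.sum_const, smul_eq_mul] at h1
  rw [h1] at h2
  push_cast at h2
  omega

end IsVectorOvoid

theorem IsMinusType.exists_isOneSystem (h : IsMinusType Q)
    {O : Set (Projectivization (ZMod 2) V)} (hO : IsOvoid Q 3 O) :
    ∃ L, IsOneSystem Q L ∧ O = ⋃ l ∈ L, pointsOf l := by
  have hS := isOvoid_iff.1 hO
  have hsub : ∀ W : Submodule (ZMod 2) V, (∀ w ∈ W, w ≠ 0 → w ∈ vectors O) → pointsOf W ⊆ O :=
    fun W hW P hP => rep_mem_vectors.1 (hW _ (mem_pointsOf.1 hP) P.rep_nonzero)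
  refine ⟨{W | IsLine Q W ∧ ∀ w ∈ W, w ≠ 0 → w ∈ vectors O},
    ⟨fun l hl => hl.1, ?_, ?_, ?_⟩, ?_⟩
  · have := hS.card_filter_lines h
    rw [← Set.ncard_coe_finset] at this
    simpa using this
  · intro l hl k hk hne
    refine Set.disjoint_left.2 fun P hP hP' => hne ?_
    exact hS.line_unique h hl.1.2 hl.2 hk.1.2 hk.2 P.rep_nonzero (mem_pointsOf.1 hP)
      (mem_pointsOf.1 hP')
  · intro l hl E hE hlE
    rw [Set.disjoint_left]
    intro P hPE hPk
    simp only [Set.mem_iUnion] at hPk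
    obtain ⟨k, ⟨hk, hkl⟩, hPk⟩ := hPk
    -- E meets O in three points only, and these are the points of l.
    have h3 := hS.2 E (h.isGenerator_of_isPlane hE)
    have e : (univ.filter (· ∈ l)).erase 0 = (vectors O).filter (· ∈ E) := by
      refine Finset.eq_of_subset_of_card_le (fun x hx => ?_) ?_
      · simp only [mem_filter, mem_univ, true_and, mem_erase] at hx ⊢
        exact ⟨hl.2 x hx.2 hx.1, hlE hx.2⟩
      · rw [h3, Finset.card_erase_of_mem (by simp), card_of_finrank_eq hl.1.2]
        norm_num
    have hP : P.rep ∈ (vectors O).filter (· ∈ E) :=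
      Finset.mem_filter.2 ⟨rep_mem_vectors.2 (hsub k hk.2 hPk), mem_pointsOf.1 hPE⟩
    rw [← e] at hP
    simp only [mem_filter, mem_univ, true_and, mem_erase] at hP
    exact hkl (hS.line_unique h hk.1.2 hk.2 hl.1.2 hl.2 hP.1 (mem_pointsOf.1 hPk) hP.2)
  · ext P
    simp only [Set.mem_iUnion, exists_prop]
    constructor
    · intro hP
      obtain ⟨W, h1, h2, h3⟩ := hS.exists_line h (rep_mem_vectors.2 hP)
      exact ⟨W, ⟨h1, h2⟩, mem_pointsOf.2 h3⟩
    · rintro ⟨W, hW, hP⟩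
      exact hsub W hW.2 hP

end Lines

end PolarSpace

/-! ### The main theorem. -/

theorem mainTheorem3 {V : Type*} [AddCommGroup V] [Module (ZMod 2) V]
    (Q : QuadraticForm (ZMod 2) V) (hQ : PolarSpace.IsElliptic 3 Q) :
    (∀ m : ℕ,
      (∃ O, PolarSpace.IsOvoid Q m O ∧ ¬ PolarSpace.IsTrivialOvoid Q O) ↔ m = 3 ∨ m = 4) ∧
    (∀ O, PolarSpace.IsOvoid Q 3 O →
      ∃ L, PolarSpace.IsOneSystem Q L ∧ O = ⋃ l ∈ L, PolarSpace.pointsOf l) ∧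
    (∀ O, PolarSpace.IsOvoid Q 4 O ↔
      ∃ O', PolarSpace.IsOvoid Q 3 O' ∧ O = PolarSpace.quadricPoints Q \ O') := by
  obtain ⟨e, he⟩ := PolarSpace.exists_equiv_standardForm hQ
  have : Fintype V := Fintype.ofEquiv _ e.symm.toEquiv
  have h := PolarSpace.isMinusType_of_equiv e he
  refine ⟨fun m => ⟨?_, ?_⟩, fun O hO => h.exists_isOneSystem hO, fun O => ⟨fun hO => ?_, ?_⟩⟩
  · rintro ⟨O, hO, hnt⟩
    have h3 := h.three_le_of_isOvoid hO (Set.nonempty_iff_ne_empty.2 fun hc => hnt (Or.inl hc))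
    have h4 := h.three_le_of_isOvoid (h.isOvoid_compl hO) (by
      rw [Set.sdiff_nonempty]
      exact fun hc => hnt (Or.inr (hO.1.antisymm hc)))
    -- 3 ≤ m and 3 ≤ 7 - m.
    omega
  · obtain ⟨S, hS⟩ := PolarSpace.exists_isVectorOvoid_three e he
    rw [← PolarSpace.vectors_of_finset hS.zero_notMem, ← PolarSpace.isOvoid_iff] at hS
    rintro (rfl | rfl)
    · exact ⟨_, hS, h.not_isTrivialOvoid hS (by norm_num) (by norm_num)⟩
    · exact ⟨_, h.isOvoid_compl hS,
        h.not_isTrivialOvoid (h.isOvoid_compl hS) (by norm_num) (by norm_num)⟩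
  · refine ⟨_, h.isOvoid_compl hO, ?_⟩
    rw [Set.sdiff_sdiff_cancel_left hO.1]
  · rintro ⟨O', hO', rfl⟩
    exact h.isOvoid_compl hO'
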